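/- Let $M$ be a smooth manifold, $H$ a closed three-form on $M$, and let $\mathbb{T}M=TM\oplus T^*M$ carry the Dorfman bracket $$[[X+\xi,Y+\eta]]^H=[X,Y]+L_X\eta-\iota_Y d\xi+\iota_Y\iota_X H,\qquad [[a,b]]^H_{sk}=\tfrac12\big([[a,b]]^H-[[b,a]]^H\big),$$ with anchor $\rho:\mathbb{T}M\to TM$ the projection. Let $E\to M$ be a smooth real vector bundle of finite rank and let $D$ be a generalized (Courant algebroid) connection on $E$, i.e. a first order linear operator $D:\Gamma(E)\to\Gamma(\mathbb{T}M\otimes E)$ with $D(f\sigma)=fD\sigma+(\rho^*df)\otimes\sigma$; write $D_a=\iota_aD$ and $D=\nabla+V$, where $\nabla_X=D_{X+0}$ is an ordinary connection on $E$ and $V\in\Gamma(TM\otimes\mathrm{End}\,E)$ is given by $V_\xi=D_{0+\xi}$. Let $\nabla^K$ be an affine connection on $M$, acting on one-forms by duality. For $a=X+\xi$, $b=Y+\eta\in\Gamma(\mathbb{T}M)$ define the naive curvature operator $$R_D(a,b)=[D_a,D_b]-D_{[[a,b]]^H_{sk}}$$ and the $K$-curvature $R^K_D=R_\nabla+V\wedge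 V+\nabla^{\Gamma K}(V)$, that is, $$R^K_D(a,b)=R_\nabla(X,Y)+[V_\xi,V_\eta]+(\nabla_XV)(\eta)-(\nabla_YV)(\xi),$$ where $R_\nabla(X,Y)=[\nabla_X,\nabla_Y]-\nabla_{[X,Y]}$ and $(\nabla_XV)(\eta)=[\nabla_X,V_\eta]-V_{\nabla^K_X\eta}$ is the covariant derivative of $V$ for the connection induced by $\nabla$ and $\nabla^K$ on $TM\otimes\mathrm{End}\,E$. Set $$\tilde K(X+\xi,Y+\eta)=[[X+\xi,Y+\eta]]^H_{sk}-[X,Y]+\nabla^K_Y\xi-\nabla^K_X\eta .$$ Then, for all $a,b\in\Gamma(\mathbb{T}M)$, $\tilde K(a,b)$ is a one-form (its $TM$-component vanishes), and as operators on $\Gamma(E)$ $$R^K_D(a,b)=R_D(a,b)+V_{\tilde K(a,b)} .$$ -/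

import Mathlib

open Bundle Set Filter Topology VectorField
open scoped Manifold ContDiff Bundle

noncomputable section

namespace CourantGeometry

section Basics

variable {E : Type*} [NormedAddCommGroup E] [NormedSpace ℝ E]
  {H : Type*} [TopologicalSpace H] (I : ModelWithCorners ℝ E H)
  {M : Type*} [TopologicalSpace M] [ChartedSpace H M]

/-- The cotangent space `T*_x M`. -/
abbrev CotangentSpace (x : M) : Type _ := TangentSpace I x →L[ℝ] Bundle.Trivial M ℝ x

/-- The fibre `T_x M ⊕ T*_x M` of the generalized tangent bundle `𝕋M`.  As a family over `M` it is
Mathlib's direct sum of the bundles `TM` and `T*M`. -/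
abbrev GenTangentSpace : M → Type _ :=
  (fun x : M ↦ TangentSpace I x) ×ᵇ (fun x : M ↦ CotangentSpace I x)

variable (M)

/-- Smooth vector fields on `M`. -/
abbrev SmoothVectorField [IsManifold I ∞ M] : Type _ :=
  Cₛ^∞⟮I; E, (fun x : M ↦ TangentSpace I x)⟯

/-- Smooth one-forms on `M`, as smooth sections of the cotangent bundle. -/
abbrev SmoothOneForm [IsManifold I ∞ M] : Type _ :=
  Cₛ^∞⟮I; E →L[ℝ] ℝ, (fun x : M ↦ CotangentSpace I x)⟯

/-- Smooth sections `X + ξ` of `𝕋M = TM ⊕ T*M`. -/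
structure GenSection [IsManifold I ∞ M] where
  /-- the vector field `X`; this is the anchor applied to the section -/
  vec : SmoothVectorField I M
  /-- the one-form `ξ` -/
  form : SmoothOneForm I M

variable {M} {I}

/-- The value of `X + ξ` at a point. -/
def GenSection.val [IsManifold I ∞ M] (a : GenSection I M) (x : M) : GenTangentSpace I x :=
  (a.vec x, a.form x)

end Basics

section Forms

variable {E : Type*} [NormedAddCommGroup E] [NormedSpace ℝ E]
  {H : Type*} [TopologicalSpace H] {I : ModelWithCorners ℝ E H}
  {M : Type*} [TopologicalSpace M] [ChartedSpace H M] [IsManifold I ∞ M]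

/-- The function `η(Z)`. -/
def formApply (η : SmoothOneForm I M) (Z : Π x : M, TangentSpace I x) : M → ℝ := fun x ↦ η x (Z x)

lemma mdifferentiableAt_formApply (η : SmoothOneForm I M) {Z : Π x : M, TangentSpace I x} {x : M}
    (hZ : MDiffAt (T% Z) x) : MDiffAt (formApply η Z) x := by
  have h : MDifferentiableAt I (I.prod 𝓘(ℝ, ℝ))
      (fun m ↦ TotalSpace.mk' ℝ (E := Bundle.Trivial M ℝ) m (η m (Z m))) x := by
    apply MDifferentiableAt.clm_bundle_apply (F₁ := E)
    · exact η.mdifferentiableAt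
    · exact hZ
  rw [mdifferentiableAt_totalSpace] at h
  exact h.2

lemma mvfderiv_formApply_smul (η : SmoothOneForm I M) {f : M → ℝ} {Z : Π x : M, TangentSpace I x}
    {x : M} (hf : MDiffAt f x) (hZ : MDiffAt (T% Z) x) (v : TangentSpace I x) :
    mvfderiv I (formApply η (f • Z)) x v =
      f x * mvfderiv I (formApply η Z) x v + mvfderiv I f x v * η x (Z x) := by
  have h1 : formApply η (f • Z) = fun y ↦ f y * formApply η Z y := by
    funext y; simp [formApply]
  rw [h1, mvfderiv_fun_mul hf (mdifferentiableAt_formApply η hZ)]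
  simp [formApply, mul_comm]

lemma mvfderiv_formApply_add (η : SmoothOneForm I M) {Z Z' : Π x : M, TangentSpace I x}
    {x : M} (hZ : MDiffAt (T% Z) x) (hZ' : MDiffAt (T% Z') x) (v : TangentSpace I x) :
    mvfderiv I (formApply η (Z + Z')) x v =
      mvfderiv I (formApply η Z) x v + mvfderiv I (formApply η Z') x v := by
  have h1 : formApply η (Z + Z') = fun y ↦ formApply η Z y + formApply η Z' y := by
    funext y; simp [formApply]
  rw [h1, mvfderiv_fun_add (mdifferentiableAt_formApply η hZ) (mdifferentiableAt_formApply η hZ')]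
  simp

/-- `v(η(Z)) - η(∇_v Z)` for a tangent vector `v` at `x` and an affine connection `∇`. -/
def dualConnectionAux (K : CovariantDerivative I E (fun x : M ↦ TangentSpace I x))
    (η : SmoothOneForm I M) (x : M) (v : TangentSpace I x) (Z : Π x : M, TangentSpace I x) : ℝ :=
  mvfderiv I (formApply η Z) x v - η x (K Z x v)

lemma tensorialAt_dualConnectionAux (K : CovariantDerivative I E (fun x : M ↦ TangentSpace I x))
    (η : SmoothOneForm I M) (x : M) (v : TangentSpace I x) :
    TensorialAt I E (dualConnectionAux K η x v) x where
  smul {f Z} hf hZ := by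
    simp [dualConnectionAux, mvfderiv_formApply_smul η hf hZ,
      K.isCovariantDerivativeOn.leibniz hZ hf]
    ring
  add {Z Z'} hZ hZ' := by
    simp [dualConnectionAux, mvfderiv_formApply_add η hZ hZ',
      K.isCovariantDerivativeOn.add hZ hZ']
    ring

variable [FiniteDimensional ℝ E]

/-- `X(η(Z)) - η([X, Z])` at `x`. -/
def lieDerivAux (X : SmoothVectorField I M) (η : SmoothOneForm I M) (x : M)
    (Z : Π x : M, TangentSpace I x) : ℝ :=
  mvfderiv I (formApply η Z) x (X x) - η x (mlieBracket I X Z x)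

lemma tensorialAt_lieDerivAux (X : SmoothVectorField I M) (η : SmoothOneForm I M) (x : M) :
    TensorialAt I E (lieDerivAux X η x) x where
  smul {f Z} hf hZ := by
    have : CompleteSpace E := FiniteDimensional.complete ℝ E
    simp [lieDerivAux, mvfderiv_formApply_smul η hf hZ, mlieBracket_smul_right hf hZ]
    ring
  add {Z Z'} hZ hZ' := by
    have : CompleteSpace E := FiniteDimensional.complete ℝ E
    simp [lieDerivAux, mvfderiv_formApply_add η hZ hZ', mlieBracket_add_right hZ hZ']
    ring

/-- The Lie derivative `L_X η` of a one-form: `(L_X η)(Z) = X(η(Z)) - η([X, Z])`. -/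
def lieDeriv (X : SmoothVectorField I M) (η : SmoothOneForm I M) (x : M) : CotangentSpace I x :=
  TensorialAt.mkHom (A := ℝ) (lieDerivAux X η x) x (tensorialAt_lieDerivAux X η x)

/-- `Y(ξ(Z)) - Z(ξ(Y)) - ξ([Y, Z])` at `x`. -/
def extDerivAux (ξ : SmoothOneForm I M) (x : M) (Y Z : Π x : M, TangentSpace I x) : ℝ :=
  mvfderiv I (formApply ξ Z) x (Y x) - mvfderiv I (formApply ξ Y) x (Z x)
    - ξ x (mlieBracket I Y Z x)

lemma tensorialAt_extDerivAux_right (ξ : SmoothOneForm I M) (x : M)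
    (Y : Π x : M, TangentSpace I x) : TensorialAt I E (fun Z ↦ extDerivAux ξ x Y Z) x where
  smul {f Z} hf hZ := by
    have : CompleteSpace E := FiniteDimensional.complete ℝ E
    simp [extDerivAux, mvfderiv_formApply_smul ξ hf hZ, mlieBracket_smul_right hf hZ]
    ring
  add {Z Z'} hZ hZ' := by
    have : CompleteSpace E := FiniteDimensional.complete ℝ E
    simp [extDerivAux, mvfderiv_formApply_add ξ hZ hZ', mlieBracket_add_right hZ hZ']
    ring

lemma tensorialAt_extDerivAux_left (ξ : SmoothOneForm I M) (x : M)
    (Z : Π x : M, TangentSpace I x) : TensorialAt I E (fun Y ↦ extDerivAux ξ x Y Z) x where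
  smul {f Y} hf hY := by
    have : CompleteSpace E := FiniteDimensional.complete ℝ E
    simp [extDerivAux, mvfderiv_formApply_smul ξ hf hY, mlieBracket_smul_left hf hY]
    ring
  add {Y Y'} hY hY' := by
    have : CompleteSpace E := FiniteDimensional.complete ℝ E
    simp [extDerivAux, mvfderiv_formApply_add ξ hY hY', mlieBracket_add_left hY hY']
    ring

/-- The exterior derivative `dξ` of a one-form:
`dξ(Y, Z) = Y(ξ(Z)) - Z(ξ(Y)) - ξ([Y, Z])`. -/
def extDeriv (ξ : SmoothOneForm I M) (x : M) : TangentSpace I x →L[ℝ] CotangentSpace I x :=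
  TensorialAt.mkHom₂ (A := ℝ) (extDerivAux ξ x) x
    (fun Z _ ↦ tensorialAt_extDerivAux_left ξ x Z)
    (fun Y _ ↦ tensorialAt_extDerivAux_right ξ x Y)

variable (I M) in
set_option maxSynthPendingDepth 3 in
/-- Smooth closed three-forms `H` on `M`; closedness is the usual invariant formula for
`dH(X₀, X₁, X₂, X₃) = 0`. -/
structure ClosedThreeForm where
  /-- the value at a point, a trilinear form on the tangent space -/
  toFun : Π x : M, TangentSpace I x →L[ℝ] TangentSpace I x →L[ℝ] CotangentSpace I x
  alt_left : ∀ (x : M) (u w : TangentSpace I x), toFun x u u w = 0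
  alt_right : ∀ (x : M) (u w : TangentSpace I x), toFun x u w w = 0
  contMDiff : ContMDiff I (I.prod 𝓘(ℝ, E →L[ℝ] E →L[ℝ] E →L[ℝ] ℝ)) ∞
    (fun x ↦ TotalSpace.mk' (E →L[ℝ] E →L[ℝ] E →L[ℝ] ℝ)
      (E := fun x : M ↦ TangentSpace I x →L[ℝ] TangentSpace I x →L[ℝ] CotangentSpace I x)
      x (toFun x))
  closed : ∀ (x : M) (X₀ X₁ X₂ X₃ : Π x : M, TangentSpace I x),
    CMDiffAt ∞ (T% X₀) x → CMDiffAt ∞ (T% X₁) x → CMDiffAt ∞ (T% X₂) x → CMDiffAt ∞ (T% X₃) x →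
      mvfderiv I (fun y ↦ (toFun y (X₁ y) (X₂ y) (X₃ y) : ℝ)) x (X₀ x)
      - mvfderiv I (fun y ↦ (toFun y (X₀ y) (X₂ y) (X₃ y) : ℝ)) x (X₁ x)
      + mvfderiv I (fun y ↦ (toFun y (X₀ y) (X₁ y) (X₃ y) : ℝ)) x (X₂ x)
      - mvfderiv I (fun y ↦ (toFun y (X₀ y) (X₁ y) (X₂ y) : ℝ)) x (X₃ x)
      - toFun x (mlieBracket I X₀ X₁ x) (X₂ x) (X₃ x)
      + toFun x (mlieBracket I X₀ X₂ x) (X₁ x) (X₃ x)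
      - toFun x (mlieBracket I X₀ X₃ x) (X₁ x) (X₂ x)
      - toFun x (mlieBracket I X₁ X₂ x) (X₀ x) (X₃ x)
      + toFun x (mlieBracket I X₁ X₃ x) (X₀ x) (X₂ x)
      - toFun x (mlieBracket I X₂ X₃ x) (X₀ x) (X₁ x) = 0

/-- The Dorfman bracket
`[[X + ξ, Y + η]]^H = [X, Y] + L_X η - ι_Y dξ + ι_Y ι_X H`. -/
def dorfmanBracket (H₃ : ClosedThreeForm I M) (a b : GenSection I M) (x : M) :
    GenTangentSpace I x :=
  (mlieBracket I a.vec b.vec x,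
    lieDeriv a.vec b.form x - extDeriv a.form x (b.vec x) + H₃.toFun x (a.vec x) (b.vec x))

/-- The skew-symmetrized bracket `[[a, b]]_sk = ½ ([[a, b]] - [[b, a]])`. -/
def skewBracket (H₃ : ClosedThreeForm I M) (a b : GenSection I M) (x : M) :
    GenTangentSpace I x :=
  (2⁻¹ : ℝ) • (dorfmanBracket H₃ a b x - dorfmanBracket H₃ b a x)

/-- The action `∇_v η` on one-forms of an affine connection `∇`, given by
`(∇_v η)(Z) = v(η(Z)) - η(∇_v Z)`. -/
def dualConnection (K : CovariantDerivative I E (fun x : M ↦ TangentSpace I x))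
    (η : SmoothOneForm I M) (x : M) (v : TangentSpace I x) : CotangentSpace I x :=
  TensorialAt.mkHom (A := ℝ) (dualConnectionAux K η x v) x
    (tensorialAt_dualConnectionAux K η x v)

/-- `K̃(X + ξ, Y + η) = [[X + ξ, Y + η]]_sk - [X, Y] + ∇^K_Y ξ - ∇^K_X η`. -/
def kTilde (H₃ : ClosedThreeForm I M)
    (K : CovariantDerivative I E (fun x : M ↦ TangentSpace I x))
    (a b : GenSection I M) (x : M) : GenTangentSpace I x :=
  skewBracket H₃ a b x - (mlieBracket I a.vec b.vec x, 0)
    + (0, dualConnection K a.form x (b.vec x)) - (0, dualConnection K b.form x (a.vec x))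

end Forms

section Connections

variable {E : Type*} [NormedAddCommGroup E] [NormedSpace ℝ E]
  {H : Type*} [TopologicalSpace H] (I : ModelWithCorners ℝ E H)
  {M : Type*} [TopologicalSpace M] [ChartedSpace H M] [IsManifold I ∞ M]
  (F : Type*) [NormedAddCommGroup F] [NormedSpace ℝ F]
  (V : M → Type*) [TopologicalSpace (TotalSpace F V)]
  [∀ x, AddCommGroup (V x)] [∀ x, Module ℝ (V x)] [∀ x, TopologicalSpace (V x)]
  [∀ x, IsTopologicalAddGroup (V x)] [∀ x, ContinuousSMul ℝ (V x)]
  [FiberBundle F V] [VectorBundle ℝ F V]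

/-- A (smooth) generalized connection on a vector bundle `V → M`, i.e. a first order operator
`D : Γ(V) → Γ(𝕋M ⊗ V)` with `D(fσ) = f Dσ + (ρ^* df) ⊗ σ`.  The bundle `𝕋M ⊗ V` is identified
with `Hom(𝕋M, V)` through the pairing of `𝕋M`, so that `D_a σ (x) = D σ x (a x)`, and
`ρ^* df` is `df` composed with the anchor `𝕋M → TM`.  As for Mathlib's `CovariantDerivative`,
`D` takes arbitrary sections as input, but the conditions only concern differentiable ones. -/
structure GeneralizedConnection where
  /-- the operator -/
  toFun : (Π x : M, V x) → (Π x : M, GenTangentSpace I x →L[ℝ] V x)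
  add : ∀ {σ σ' : Π x : M, V x} {x : M}, MDiffAt (T% σ) x → MDiffAt (T% σ') x →
    toFun (σ + σ') x = toFun σ x + toFun σ' x
  leibniz : ∀ {σ : Π x : M, V x} {f : M → ℝ} {x : M}, MDiffAt (T% σ) x → MDiffAt f x →
    toFun (f • σ) x = f x • toFun σ x
      + ((mvfderiv I f x).comp
          (ContinuousLinearMap.fst ℝ (TangentSpace I x) (CotangentSpace I x))).smulRight (σ x)
  contMDiff : ∀ {σ : Π x : M, V x}, CMDiff ∞ (T% σ) →
    ContMDiff I (I.prod 𝓘(ℝ, (E × (E →L[ℝ] ℝ)) →L[ℝ] F)) ∞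
      (fun x ↦ TotalSpace.mk' ((E × (E →L[ℝ] ℝ)) →L[ℝ] F)
        (E := fun x : M ↦ GenTangentSpace I x →L[ℝ] V x) x (toFun σ x))

variable {I F V}

namespace GeneralizedConnection

variable (D : GeneralizedConnection I F V)

/-- The ordinary connection `∇` in the decomposition `D = ∇ + V`: `∇_X = D_{X + 0}`. -/
def nabla : CovariantDerivative I F V where
  toFun σ x := (D.toFun σ x).comp
    (ContinuousLinearMap.inl ℝ (TangentSpace I x) (CotangentSpace I x))
  isCovariantDerivativeOnUniv :=
    { add := by
        intro σ σ' x hσ hσ' _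
        ext v
        simp [D.add hσ hσ']
      leibniz := by
        intro σ f x hσ hf _
        ext v
        simp [D.leibniz hσ hf] }

/-- The part of `D σ` along the cotangent directions. -/
def cotangentPart (σ : Π x : M, V x) (x : M) : CotangentSpace I x →L[ℝ] V x :=
  (D.toFun σ x).comp (ContinuousLinearMap.inr ℝ (TangentSpace I x) (CotangentSpace I x))

lemma tensorialAt_cotangentPart (x : M) (ξ : CotangentSpace I x) :
    TensorialAt I F (fun σ ↦ D.cotangentPart σ x ξ) x where
  smul hf hσ := by
    simp [cotangentPart, D.leibniz hσ hf]
  add hσ hσ' := by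
    simp [cotangentPart, D.add hσ hσ']

variable [ContMDiffVectorBundle ∞ F V I] [FiniteDimensional ℝ F]

/-- The tensor `V ∈ Γ(TM ⊗ End V)` in the decomposition `D = ∇ + V`: for a covector `ξ` at `x`,
the endomorphism `V_ξ = D_{0 + ξ}` of the fibre at `x`. -/
def tensor (x : M) : CotangentSpace I x →ₗ[ℝ] (V x →L[ℝ] V x) where
  toFun ξ := TensorialAt.mkHom (fun σ ↦ D.cotangentPart σ x ξ) x (D.tensorialAt_cotangentPart x ξ)
  map_add' ξ ξ' := by
    ext v
    simp [TensorialAt.mkHom_apply_eq_extend]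
  map_smul' c ξ := by
    ext v
    simp [TensorialAt.mkHom_apply_eq_extend]

/-- The decomposition `D = ∇ + V`. -/
lemma toFun_eq_nabla_add_tensor {σ : Π x : M, V x} {x : M} (hσ : MDiffAt (T% σ) x)
    (v : TangentSpace I x) (ξ : CotangentSpace I x) :
    D.toFun σ x (v, ξ) = D.nabla σ x v + D.tensor x ξ (σ x) := by
  have h : D.tensor x ξ (σ x) = D.toFun σ x (0, ξ) :=
    TensorialAt.mkHom_apply (D.tensorialAt_cotangentPart x ξ) hσ
  have h' : D.nabla σ x v = D.toFun σ x (v, 0) := rfl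
  rw [h, h', ← map_add]
  simp

end GeneralizedConnection

/-- The curvature `R_∇(X, Y)σ = ∇_X ∇_Y σ - ∇_Y ∇_X σ - ∇_{[X, Y]} σ` of an ordinary connection. -/
def curvature (cov : CovariantDerivative I F V) (X Y : Π x : M, TangentSpace I x)
    (σ : Π x : M, V x) (x : M) : V x :=
  cov (fun y ↦ cov σ y (Y y)) x (X x) - cov (fun y ↦ cov σ y (X y)) x (Y x)
    - cov σ x (mlieBracket I X Y x)

namespace GeneralizedConnection

variable (D : GeneralizedConnection I F V)

/-- The naive curvature operator `R_D(a, b)σ = D_a D_b σ - D_b D_a σ - D_{[[a, b]]_sk} σ`. -/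
def naiveCurvature [FiniteDimensional ℝ E] (H₃ : ClosedThreeForm I M) (a b : GenSection I M)
    (σ : Π x : M, V x) (x : M) : V x :=
  D.toFun (fun y ↦ D.toFun σ y (b.val y)) x (a.val x)
    - D.toFun (fun y ↦ D.toFun σ y (a.val y)) x (b.val x)
    - D.toFun σ x (skewBracket H₃ a b x)

variable [ContMDiffVectorBundle ∞ F V I] [FiniteDimensional ℝ F]

/-- `V ∧ V`: the two-vector field with values in endomorphisms
`(ξ, η) ↦ V_ξ V_η - V_η V_ξ`. -/
def wedge (x : M) (ξ η : CotangentSpace I x) : V x →L[ℝ] V x :=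
  (D.tensor x ξ).comp (D.tensor x η) - (D.tensor x η).comp (D.tensor x ξ)

/-- The covariant derivative of the section `V` of `TM ⊗ End V` for the connection induced by `∇`
on `End V` and by the affine connection `∇^K` on `TM`:
`(∇_X V)(η) σ = ∇_X (V_η σ) - V_η (∇_X σ) - V_{∇^K_X η} σ`. -/
def covDerivTensor [FiniteDimensional ℝ E]
    (K : CovariantDerivative I E (fun x : M ↦ TangentSpace I x))
    (X : SmoothVectorField I M) (η : SmoothOneForm I M) (σ : Π x : M, V x) (x : M) : V x :=
  D.nabla (fun y ↦ D.tensor y (η y) (σ y)) x (X x)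
    - D.tensor x (η x) (D.nabla σ x (X x))
    - D.tensor x (dualConnection K η x (X x)) (σ x)

/-- The `K`-curvature `R^K_D = R_∇ + V ∧ V + ∇^{ΓK} V`, evaluated on `a = X + ξ`, `b = Y + η`;
the section `∇^{ΓK} V` of `T*M ⊗ TM ⊗ End V` is viewed as the part of a section of
`Λ² 𝕋M ⊗ End V` with value `(∇_X V)(η) - (∇_Y V)(ξ)`. -/
def kCurvature [FiniteDimensional ℝ E]
    (K : CovariantDerivative I E (fun x : M ↦ TangentSpace I x))
    (a b : GenSection I M) (σ : Π x : M, V x) (x : M) : V x :=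
  curvature D.nabla a.vec b.vec σ x
    + D.wedge x (a.form x) (b.form x) (σ x)
    + (D.covDerivTensor K a.vec b.form σ x - D.covDerivTensor K b.vec a.form σ x)

end GeneralizedConnection

end Connections

end CourantGeometry

end

/-!
With `X + ξ = a` and `Y + η = b`, the decomposition `D_a = ∇_X + V_ξ` turns the naive curvature
into a sum of commutators
`R_D(a, b) = [∇_X, ∇_Y] + [V_ξ, V_η] + [∇_X, V_η] - [∇_Y, V_ξ] - D_{[[a, b]]_sk}`.
The Lie bracket being antisymmetric, `[[a, b]]_sk` has vector part `[X, Y]`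
(`CourantGeometry.skewBracket_fst`), so its last term contributes `∇_{[X, Y]}`, which completes
`R_∇(X, Y)`, and `V` on the one-form part.  The `K`-curvature differs from this by
`V_{∇^K_Y ξ - ∇^K_X η}` and by the one-form part of `[[a, b]]_sk`, whose sum is by definition the
one-form `K̃(a, b)`; hence the claim, by linearity of `V`.

Expanding `D_a D_b σ` requires additivity of `D` on `∇_Y σ + V_η σ`, which is available
only for differentiable sections.  Both summands are `D σ` evaluated on a smooth section of `𝕋M`,
so they are smooth (`CourantGeometry.GeneralizedConnection.contMDiff_toFun_apply`).
-/

section ProdSection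

variable {𝕜 : Type*} [NontriviallyNormedField 𝕜]
  {B : Type*} [TopologicalSpace B]
  {EB : Type*} [NormedAddCommGroup EB] [NormedSpace 𝕜 EB]
  {HB : Type*} [TopologicalSpace HB] {IB : ModelWithCorners 𝕜 EB HB} [ChartedSpace HB B]
  {F₁ : Type*} [NormedAddCommGroup F₁] [NormedSpace 𝕜 F₁]
  {F₂ : Type*} [NormedAddCommGroup F₂] [NormedSpace 𝕜 F₂]
  {E₁ : B → Type*} [TopologicalSpace (TotalSpace F₁ E₁)] [∀ x, TopologicalSpace (E₁ x)]
  [∀ x, Zero (E₁ x)] [FiberBundle F₁ E₁]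
  {E₂ : B → Type*} [TopologicalSpace (TotalSpace F₂ E₂)] [∀ x, TopologicalSpace (E₂ x)]
  [∀ x, Zero (E₂ x)] [FiberBundle F₂ E₂]

/-- A section of a direct sum of bundles is `C^n` if its two components are. -/
lemma ContMDiff.prodMk_section {n : ℕ∞ω} {s : Π x, E₁ x} {t : Π x, E₂ x}
    (hs : ContMDiff IB (IB.prod 𝓘(𝕜, F₁)) n (fun x ↦ TotalSpace.mk' F₁ x (s x)))
    (ht : ContMDiff IB (IB.prod 𝓘(𝕜, F₂)) n (fun x ↦ TotalSpace.mk' F₂ x (t x))) :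
    ContMDiff IB (IB.prod 𝓘(𝕜, F₁ × F₂)) n
      (fun x ↦ TotalSpace.mk' (F₁ × F₂) (E := E₁ ×ᵇ E₂) x (s x, t x)) := by
  intro x
  rw [Bundle.contMDiffAt_section]
  exact ((Bundle.contMDiffAt_section x).1 (hs x)).prodMk_space
    ((Bundle.contMDiffAt_section x).1 (ht x))

end ProdSection

namespace CourantGeometry

section Brackets

variable {E : Type*} [NormedAddCommGroup E] [NormedSpace ℝ E] [FiniteDimensional ℝ E]
  {H : Type*} [TopologicalSpace H] {I : ModelWithCorners ℝ E H}
  {M : Type*} [TopologicalSpace M] [ChartedSpace H M] [IsManifold I ∞ M]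

lemma skewBracket_fst (H₃ : ClosedThreeForm I M) (a b : GenSection I M) (x : M) :
    (skewBracket H₃ a b x).1 = mlieBracket I a.vec b.vec x := by
  have h : (skewBracket H₃ a b x).1
      = (2⁻¹ : ℝ) • (mlieBracket I a.vec b.vec x - mlieBracket I b.vec a.vec x) := rfl
  rw [h, mlieBracket_swap_apply (V := b.vec), sub_neg_eq_add, ← two_smul ℝ, smul_smul]
  norm_num

lemma kTilde_fst (H₃ : ClosedThreeForm I M)
    (K : CovariantDerivative I E (fun x : M ↦ TangentSpace I x))
    (a b : GenSection I M) (x : M) : (kTilde H₃ K a b x).1 = 0 := by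
  simp [kTilde, skewBracket_fst]

lemma kTilde_snd (H₃ : ClosedThreeForm I M)
    (K : CovariantDerivative I E (fun x : M ↦ TangentSpace I x))
    (a b : GenSection I M) (x : M) :
    (kTilde H₃ K a b x).2 = (skewBracket H₃ a b x).2
      + dualConnection K a.form x (b.vec x) - dualConnection K b.form x (a.vec x) := by
  simp [kTilde]

end Brackets

namespace GeneralizedConnection

variable {E : Type*} [NormedAddCommGroup E] [NormedSpace ℝ E]
  {H : Type*} [TopologicalSpace H] {I : ModelWithCorners ℝ E H}
  {M : Type*} [TopologicalSpace M] [ChartedSpace H M] [IsManifold I ∞ M]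
  {F : Type*} [NormedAddCommGroup F] [NormedSpace ℝ F]
  {V : M → Type*} [TopologicalSpace (TotalSpace F V)]
  [∀ x, AddCommGroup (V x)] [∀ x, Module ℝ (V x)] [∀ x, TopologicalSpace (V x)]
  [∀ x, IsTopologicalAddGroup (V x)] [∀ x, ContinuousSMul ℝ (V x)]
  [FiberBundle F V] [VectorBundle ℝ F V]
  (D : GeneralizedConnection I F V)

/-- `D_a σ` is smooth if `σ` and the section `a = X + ξ` of `𝕋M` are. -/
lemma contMDiff_toFun_apply {σ : Π x : M, V x} (hσ : CMDiff ∞ (T% σ))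
    (X : SmoothVectorField I M) (ξ : SmoothOneForm I M) :
    CMDiff ∞ (T% (fun y ↦ D.toFun σ y (X y, ξ y))) :=
  ContMDiff.clm_bundle_apply (F₁ := E × (E →L[ℝ] ℝ)) (b := fun y : M ↦ y) (D.contMDiff hσ)
    (X.contMDiff.prodMk_section ξ.contMDiff)

lemma mdifferentiableAt_nabla_apply {σ : Π x : M, V x} (hσ : CMDiff ∞ (T% σ))
    (X : SmoothVectorField I M) (x : M) : MDiffAt (T% (fun y ↦ D.nabla σ y (X y))) x :=
  (D.contMDiff_toFun_apply hσ X 0).mdifferentiableAt (by simp)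

variable [ContMDiffVectorBundle ∞ F V I] [FiniteDimensional ℝ F]

lemma tensor_apply {σ : Π x : M, V x} {x : M} (hσ : MDiffAt (T% σ) x)
    (ξ : CotangentSpace I x) : D.tensor x ξ (σ x) = D.toFun σ x (0, ξ) := by
  simpa using (D.toFun_eq_nabla_add_tensor hσ 0 ξ).symm

lemma mdifferentiableAt_tensor_apply {σ : Π x : M, V x} (hσ : CMDiff ∞ (T% σ))
    (ξ : SmoothOneForm I M) (x : M) :
    MDiffAt (T% (fun y ↦ D.tensor y (ξ y) (σ y))) x := by
  simp only [fun y ↦ D.tensor_apply (x := y) (hσ.mdifferentiableAt (by simp)) (ξ y)]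
  exact (D.contMDiff_toFun_apply hσ 0 ξ).mdifferentiableAt (by simp)

/-- The expansion `D_a D_b σ = ∇_X ∇_Y σ + ∇_X (V_η σ) + V_ξ (∇_Y σ) + V_ξ V_η σ`. -/
lemma toFun_toFun {σ : Π x : M, V x} (hσ : CMDiff ∞ (T% σ)) (a b : GenSection I M) (x : M) :
    D.toFun (fun y ↦ D.toFun σ y (b.val y)) x (a.val x) =
      D.nabla (fun y ↦ D.nabla σ y (b.vec y)) x (a.vec x)
      + D.nabla (fun y ↦ D.tensor y (b.form y) (σ y)) x (a.vec x)
      + D.tensor x (a.form x) (D.nabla σ x (b.vec x))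
      + D.tensor x (a.form x) (D.tensor x (b.form x) (σ x)) := by
  have h : (fun y ↦ D.toFun σ y (b.val y))
      = (fun y ↦ D.nabla σ y (b.vec y)) + fun y ↦ D.tensor y (b.form y) (σ y) :=
    funext fun y ↦ D.toFun_eq_nabla_add_tensor (hσ.mdifferentiableAt (by simp)) _ _
  have h₁ := D.mdifferentiableAt_nabla_apply hσ b.vec x
  have h₂ := D.mdifferentiableAt_tensor_apply hσ b.form x
  rw [h, D.add h₁ h₂, add_apply, GenSection.val,
    D.toFun_eq_nabla_add_tensor h₁, D.toFun_eq_nabla_add_tensor h₂]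
  abel

end GeneralizedConnection

end CourantGeometry

open CourantGeometry in
theorem mainTheorem3
    {E : Type*} [NormedAddCommGroup E] [NormedSpace ℝ E] [FiniteDimensional ℝ E]
    {H : Type*} [TopologicalSpace H] {I : ModelWithCorners ℝ E H}
    {M : Type*} [TopologicalSpace M] [ChartedSpace H M] [IsManifold I ∞ M]
    {F : Type*} [NormedAddCommGroup F] [NormedSpace ℝ F] [FiniteDimensional ℝ F]
    {V : M → Type*} [TopologicalSpace (TotalSpace F V)]
    [∀ x, AddCommGroup (V x)] [∀ x, Module ℝ (V x)] [∀ x, TopologicalSpace (V x)]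
    [∀ x, IsTopologicalAddGroup (V x)] [∀ x, ContinuousSMul ℝ (V x)]
    [FiberBundle F V] [VectorBundle ℝ F V] [ContMDiffVectorBundle ∞ F V I]
    (H₃ : ClosedThreeForm I M) (D : GeneralizedConnection I F V)
    (K : CovariantDerivative I E (fun x : M ↦ TangentSpace I x))
    [K.ContMDiffCovariantDerivative ∞]
    (a b : GenSection I M) (σ : Cₛ^∞⟮I; F, V⟯) (x : M) :
    (kTilde H₃ K a b x).1 = 0 ∧
      D.kCurvature K a b σ x =
        D.naiveCurvature H₃ a b σ x + D.tensor x (kTilde H₃ K a b x).2 (σ x) := by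
  refine ⟨kTilde_fst H₃ K a b x, ?_⟩
  have hσ : MDiffAt (T% (σ : Π x : M, V x)) x := σ.mdifferentiableAt
  have hskew : D.toFun σ x (skewBracket H₃ a b x) =
      D.nabla σ x (mlieBracket I a.vec b.vec x)
      + D.tensor x (skewBracket H₃ a b x).2 (σ x) := by
    rw [← skewBracket_fst H₃ a b x]
    exact D.toFun_eq_nabla_add_tensor hσ _ _
  rw [kTilde_snd, GeneralizedConnection.naiveCurvature, hskew, D.toFun_toFun σ.contMDiff,
    D.toFun_toFun σ.contMDiff]
  simp only [GeneralizedConnection.kCurvature, curvature, GeneralizedConnection.wedge,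
    GeneralizedConnection.covDerivTensor, map_add, map_sub, add_apply,
    sub_apply, ContinuousLinearMap.comp_apply]
  abel
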